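/- **Notation.** $\lg=\log_2$. For disjoint finite sets $A,B$ of numbers, $\mathrm{mixValue}(A,B)$ is the number of maximal blocks of equal letters in the string obtained by listing $A\cup B$ in increasing order and writing $\mathtt L$ for each element of $A$ and $\mathtt R$ for each element of $B$ (it is $0$ if $A\cup B=\emptyset$). An access sequence $X=(x_1,\dots,x_m)$ of integer keys is identified with the point set $G_X=\{(x_t,t):1\le t\le m\}$. For a point $p$ write $p=(p.x,p.y)$, and for a point set $P$ write $P.x=\{p.x: p\in P\}$ and $P.y=\{p.y:p\in P\}$. *Alternation bound.* A reference tree for $P$ is a binary tree in which every non-leaf node has two children and whose leaves are labelled, in increasing order from left to right, with the elements of $P.x$. Set $\mathsf{Alt}_{\mathcal T}(P)=0$ if $\mathcal T$ is a single node; otherwise, if $\mathcal T_L,\mathcal T_R$ are the left and right subtrees of the root and $P_L,P_R$ are the sets of points of $P$ whose $x$-coordinates label leaves of $\mathcal T_L$ and $\mathcal T_R$ respectively, $$\mathsf{Alt}_{\mathcal T}(P)=\mathrm{mixValue}(P_L.y,P_R.y)+\mathsf{Alt}_{\mathcal T_L}(P_L)+\mathsf{Alt}_{\mathcal T_R}(P_R).$$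 A reference tree for $X$ is one for $G_X$, and $\mathsf{Alt}_{\mathcal T}(X)=\mathsf{Alt}_{\mathcal T}(G_X)$. *Funnel bound.* For $p\in P$ let $F_L(P,p)$ (resp. $F_R(P,p)$) be the set of $q\in P$ with $q.y<p.y$ and $q.x<p.x$ (resp. $q.x>p.x$) such that the smallest closed axis-aligned rectangle containing $p$ and $q$ contains no point of $P$ other than $p,q$. Then $$\mathsf{Funnel}(P)=\sum_{p\in P}\mathrm{mixValue}(F_L(P,p).y,F_R(P,p).y),\qquad \mathsf{Funnel}(X)=\mathsf{Funnel}(G_X).$$ *The sequence.* For $k\ge 1$ let $K=2^k$ and $n=2^K$. For $1\le j\le K$ let $\mathrm{rev}_j\in\{0,\dots,K-1\}$ be the number whose $k$-bit binary representation is the reversal of that of $j-1$. For $0\le i\le n/2$ let $$S_i=(i+2^{\mathrm{rev}_1},\,i+2^{\mathrm{rev}_2},\dots,i+2^{\mathrm{rev}_K}),$$ and let $\tilde X=\tilde X_k$ be the concatenation of $n$ copies of $S_0$, then $n$ copies of $S_1$, and so on, up to $n$ copies of $S_{n/2}$. **Theorem.** There are absolute constants $c,C>0$ such that for every integer $k\ge1$,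 with $n=2^{2^k}$, $\tilde X=\tilde X_k$ and $m$ the length of $\tilde X$: the set of keys occurring in $\tilde X$ is $\{1,\dots,n\}$, $m=(\tfrac n2+1)\,n\,2^k$, and 1. $\mathsf{Alt}_{\mathcal T}(\tilde X)\le C\,m$ for every reference tree $\mathcal T$ for $\tilde X$; 2. $\mathsf{Funnel}(\tilde X)\ge c\,m\lg\lg n$; 3. consequently, $\mathsf{Funnel}(\tilde X)\ge c\,\lg\lg n\cdot\bigl(\mathsf{Alt}_{\mathcal T}(\tilde X)+m\bigr)$ simultaneously for all reference trees $\mathcal T$ for $\tilde X$. -/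

import Mathlib

namespace Wilber

/-- The two letters `L` and `R` of mixing strings. -/
inductive Side : Type
  | L : Side
  | R : Side
  deriving DecidableEq

section General

variable {α : Type*} [LinearOrder α]

/-- The mixing string of two disjoint finite sets `A` and `B`: the union is listed in increasing
order, elements of `A` are replaced by `L`, and elements of `B` by `R`. -/
def mix (A B : Finset α) : List Side :=
  ((A ∪ B).sort (· ≤ ·)).map (fun x => if x ∈ A then Side.L else Side.R)

/-- The number of maximal contiguous blocks of equal letters of a string: `0` for the empty
string, otherwise one plus the number of positions with `s_i ≠ s_{i+1}`. -/
def blocks : List Side → ℕ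
  | [] => 0
  | [_] => 1
  | a :: b :: s => (if a = b then 0 else 1) + blocks (b :: s)

/-- The mixing value of two disjoint finite sets. -/
def mixValue (A B : Finset α) : ℕ := blocks (mix A B)

/-- The set `P.x` of the `x`-coordinates (keys) of a point set. -/
def xs (P : Finset (α × α)) : Finset α := P.image Prod.fst

/-- The set `P.y` of the `y`-coordinates (times) of a point set. -/
def ys (P : Finset (α × α)) : Finset α := P.image Prod.snd

/-- Binary trees in which every internal node has two children and the leaves carry labels. -/
inductive RefTree (α : Type*) : Type _
  | leaf : α → RefTree α
  | node : RefTree α → RefTree α → RefTree α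

/-- The labels of the leaves of a tree, from left to right. -/
def RefTree.leaves {α : Type*} : RefTree α → List α
  | .leaf a => [a]
  | .node l r => l.leaves ++ r.leaves

/-- `T` is a reference tree for `P`: its leaves are labelled, in increasing order from left to
right, with the elements of `P.x`. -/
def RefTree.IsRefTree (T : RefTree α) (P : Finset (α × α)) : Prop :=
  T.leaves.Pairwise (· < ·) ∧ T.leaves.toFinset = xs P

/-- The Alternation bound of a point set with respect to a reference tree. -/
def altPts : RefTree α → Finset (α × α) → ℕ
  | .leaf _, _ => 0
  | .node l r, P =>
      mixValue (ys (P.filter (fun p => p.1 ∈ l.leaves))) (ys (P.filter (fun p => p.1 ∈ r.leaves)))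
        + altPts l (P.filter (fun p => p.1 ∈ l.leaves))
        + altPts r (P.filter (fun p => p.1 ∈ r.leaves))

/-- The points of `P` in the smallest closed axis-aligned rectangle containing `p` and `q`. -/
def inRect (P : Finset (α × α)) (p q : α × α) : Finset (α × α) :=
  P.filter (fun r => (min p.1 q.1 ≤ r.1 ∧ r.1 ≤ max p.1 q.1) ∧
    (min p.2 q.2 ≤ r.2 ∧ r.2 ≤ max p.2 q.2))

/-- The left funnel of `p` within `P`: the points `q` to the lower left of `p` such that the
rectangle spanned by `p` and `q` contains no other point of `P`. -/
def funnelL (P : Finset (α × α)) (p : α × α) : Finset (α × α) :=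
  P.filter (fun q => q.2 < p.2 ∧ q.1 < p.1 ∧ inRect P p q = {p, q})

/-- The right funnel of `p` within `P`: the points `q` to the lower right of `p` such that the
rectangle spanned by `p` and `q` contains no other point of `P`. -/
def funnelR (P : Finset (α × α)) (p : α × α) : Finset (α × α) :=
  P.filter (fun q => q.2 < p.2 ∧ p.1 < q.1 ∧ inRect P p q = {p, q})

/-- The Funnel bound of a point set. -/
def funnelPts (P : Finset (α × α)) : ℕ :=
  ∑ p ∈ P, mixValue (ys (funnelL P p)) (ys (funnelR P p))

end General

/-- The geometric view `{(x_i, i) | 1 ≤ i ≤ m}` of an access sequence `(x_1, …, x_m)`. -/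
def geom (X : List ℕ) : Finset (ℕ × ℕ) :=
  Finset.univ.image (fun i : Fin X.length => (X.get i, (i : ℕ) + 1))

/-- The Alternation bound of an access sequence with respect to a reference tree. -/
def Alt (T : RefTree ℕ) (X : List ℕ) : ℕ := altPts T (geom X)

/-- The Funnel bound of an access sequence. -/
def Funnel (X : List ℕ) : ℕ := funnelPts (geom X)

/-- Reversal of the `k`-bit binary representation of `i < 2 ^ k`: the bit in position `j` moves to
position `k - 1 - j`. -/
def bitRev (k i : ℕ) : ℕ :=
  ∑ j ∈ Finset.range k, if i.testBit j then 2 ^ (k - 1 - j) else 0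

/-- The bit-reversal sequence, a permutation of `0, …, 2 ^ k - 1`. -/
def bitReversal (k : ℕ) : List ℕ := (List.range (2 ^ k)).map (bitRev k)

/-- The number of keys `n = 2 ^ K`, where `K = 2 ^ k`. -/
def numKeys (k : ℕ) : ℕ := 2 ^ (2 ^ k)

/-- The block `S_i`, which lists the keys `i + 2 ^ b` with `b` running through the bit-reversal
sequence. -/
def blockS (k i : ℕ) : List ℕ := (bitReversal k).map (fun b => i + 2 ^ b)

/-- The access sequence in which `S_0` is repeated `n` times, then `S_1` is repeated `n` times,
and so on up to `S_{n/2}`. -/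
def xTilde (k : ℕ) : List ℕ :=
  (List.range (numKeys k / 2 + 1)).flatMap
    (fun i => (List.replicate (numKeys k) (blockS k i)).flatten)

end Wilber

namespace Wilber

/-! ### Blocks of strings -/

/-! Funnel lower bound. When the last `2 ^ k` accesses come from one repeated block, the accesses at
times `t - 2 ^ s`, for `s < k`, lie in the funnel of the access at time `t`: bit reversal takes no
value between its values at these two times during the window between them
(`eq_or_eq_of_bitRev_between`). Bit `s` of `t` decides the side, so the mixing value is at least the
number of runs in the `k` low bits of `t`, which averages at least `k / 2`. Here `k` is `lg lg n`.

Alternation upper bound. The keys of a block are spread geometrically, so a tree node over an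
interval of `N` keys can alternate only through steps `2 ^ b < 2 * N`. Summed over the shifts `i`, a
step `B = 2 ^ b` costs a node with `l` and `r` leaves below its children at most a constant times
`min B (min l r)`, per repetition (`sum_min_card_hits_le`). For fixed `B` these costs telescope over
the tree against a potential linear in the number of leaves (`potential_add_le`), so each of the `2
^ k` steps costs `O(n)` per repetition over the whole tree. With `n` repetitions this is `O(n ^ 2 *
2 ^ k)`, which is `O(m)`. -/

theorem blocks_cons_cons (a b : Side) (s : List Side) :
    blocks (a :: b :: s) = (if a = b then 0 else 1) + blocks (b :: s) := rfl

theorem blocks_le_blocks_cons (a : Side) (s : List Side) : blocks s ≤ blocks (a :: s) := by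
  cases s with
  | nil => simp [blocks]
  | cons b s => rw [blocks_cons_cons]; omega

theorem blocks_cons_le_blocks_cons_cons (a b : Side) (s : List Side) :
    blocks (a :: s) ≤ blocks (a :: b :: s) := by
  cases s with
  | nil => simp [blocks]
  | cons c s =>
    simp only [blocks_cons_cons]
    cases a <;> cases b <;> cases c <;> simp <;> omega

/-- The second conjunct, with a letter prepended, is what makes the induction close. -/
theorem blocks_le_of_sublist {s t : List Side} (h : s.Sublist t) :
    blocks s ≤ blocks t ∧ ∀ a, blocks (a :: s) ≤ blocks (a :: t) := by
  induction h with
  | slnil => simp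
  | @cons s t b _ ih =>
    refine ⟨ih.1.trans (blocks_le_blocks_cons _ _), fun a => (ih.2 a).trans ?_⟩
    exact blocks_cons_le_blocks_cons_cons a b t
  | @cons_cons s t b _ ih =>
    refine ⟨ih.2 b, fun a => ?_⟩
    simp only [blocks_cons_cons]
    exact Nat.add_le_add_left (ih.2 b) _

theorem blocks_append_le (s t : List Side) : blocks (s ++ t) ≤ blocks s + blocks t := by
  induction s with
  | nil => simp [blocks]
  | cons a s ih =>
    cases s with
    | nil =>
      cases t with
      | nil => simp [blocks]
      | cons b t =>
        simp only [List.singleton_append, blocks_cons_cons, blocks]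
        split_ifs <;> omega
    | cons b s =>
      simp only [List.cons_append, blocks_cons_cons] at ih ⊢
      omega

/-- Runs alternate between the two letters, and there are at most `s.count d` runs of `d`. The
versions with a first letter carry the induction. -/
theorem blocks_le_two_mul_count (s : List Side) (d : Side) :
    blocks s ≤ 2 * s.count d + 1 ∧ ∀ e, e ≠ d → blocks (d :: s) ≤ 2 * s.count d + 2 ∧
      blocks (e :: s) ≤ 2 * s.count d + 1 := by
  induction s with
  | nil => simp [blocks]
  | cons a s ih =>
    cases d <;> cases a <;> simp [blocks_cons_cons] at ih ⊢ <;>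
      refine ⟨?_, fun e he => ?_⟩ <;> (try (cases e <;> simp at he)) <;>
      (have h1 := ih.2 Side.L; have h2 := ih.2 Side.R; simp at h1 h2 ⊢; omega)

/-- One of the two possible new letters differs from the head and opens a new run. -/
theorem two_mul_blocks_lt (s : List Side) :
    2 * blocks s + 1 ≤ blocks (Side.L :: s) + blocks (Side.R :: s) := by
  cases s with
  | nil => simp [blocks]
  | cons a s => cases a <;> simp [blocks_cons_cons] <;> omega

/-- The `k` lowest binary digits of `t`, most significant first, as a string of sides. -/
def bitString (k t : ℕ) : List Side :=
  (List.range k).reverse.map (fun s => if t.testBit s then Side.L else Side.R)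

theorem bitString_succ (k t : ℕ) :
    bitString (k + 1) t = (if t.testBit k then Side.L else Side.R) :: bitString k t := by
  simp [bitString, List.range_succ]

theorem bitString_add_two_pow_mul (k t c : ℕ) : bitString k (2 ^ k * c + t) = bitString k t := by
  unfold bitString
  refine List.map_congr_left fun s hs => ?_
  have hs : s < k := by simpa using hs
  have h : (2 ^ k * c + t) % 2 ^ k = t % 2 ^ k := by simp [Nat.add_mod]
  have := congrArg (fun x => x.testBit s) h
  simp only [Nat.testBit_mod_two_pow, hs, decide_true, Bool.true_and] at this
  rw [this]

/-- The binary expansions of `0, …, 2 ^ k - 1` have at least `k / 2` blocks on average. -/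
theorem mul_two_pow_le_two_mul_sum_blocks (k : ℕ) :
    k * 2 ^ k ≤ 2 * ∑ t ∈ Finset.range (2 ^ k), blocks (bitString k t) := by
  induction k with
  | zero => simp
  | succ k ih =>
    have h1 : ∀ t ∈ Finset.range (2 ^ k), 2 * blocks (bitString k t) + 1 ≤
        blocks (bitString (k + 1) t) + blocks (bitString (k + 1) (2 ^ k + t)) := by
      intro t ht
      have ht : t < 2 ^ k := by simpa using ht
      have e1 : t.testBit k = false := Nat.testBit_lt_two_pow ht
      have e2 : (2 ^ k + t).testBit k = true := by simp [Nat.testBit_two_pow_add_eq, e1]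
      have e3 : bitString k (2 ^ k + t) = bitString k t := by
        simpa using bitString_add_two_pow_mul k t 1
      rw [bitString_succ, bitString_succ, e1, e2, e3]
      have := two_mul_blocks_lt (bitString k t)
      simp only [Bool.false_eq_true, if_false, if_true]
      omega
    have h2 := Finset.sum_le_sum h1
    rw [Finset.sum_add_distrib, Finset.sum_add_distrib, ← Finset.mul_sum] at h2
    simp only [Finset.sum_const, Finset.card_range, smul_eq_mul, mul_one] at h2
    have h3 : 2 ^ (k + 1) = 2 ^ k + 2 ^ k := by ring
    rw [h3, Finset.sum_range_add]
    nlinarith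

/-! ### Mixing values -/

section Mixing

variable {α : Type*} [LinearOrder α]

/-- Allows a mixing value to be bounded below by exhibiting only some elements of the two sets. -/
theorem blocks_map_le_mixValue {A B : Finset α} {l : List α} (hl : l.Pairwise (· < ·))
    (hmem : ∀ x ∈ l, x ∈ A ∪ B) :
    blocks (l.map (fun x => if x ∈ A then Side.L else Side.R)) ≤ mixValue A B := by
  have hsub : l.Sublist ((A ∪ B).sort (· ≤ ·)) := by
    refine List.sublist_of_subperm_of_pairwise (r := (· ≤ ·)) ?_ (hl.imp le_of_lt) (Finset.pairwise_sort _ _)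
    refine List.subperm_of_subset (hl.imp ne_of_lt) fun x hx => ?_
    simpa using hmem x hx
  exact (blocks_le_of_sublist (hsub.map _)).1

end Mixing

/-- The point set `{(f 0, 1), …, (f (m - 1), m)}`. -/
def graphPts (m : ℕ) (f : ℕ → ℕ) : Finset (ℕ × ℕ) :=
  (Finset.range m).image (fun t => (f t, t + 1))

theorem geom_map_range (m : ℕ) (f : ℕ → ℕ) : geom ((List.range m).map f) = graphPts m f := by
  ext ⟨x, y⟩
  simp only [geom, graphPts, Finset.mem_image, Finset.mem_univ, true_and, Finset.mem_range]
  constructor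
  · rintro ⟨i, hi⟩
    have := i.2
    simp only [List.length_map, List.length_range] at this
    exact ⟨i, this, by simpa using hi⟩
  · rintro ⟨t, ht, h⟩
    exact ⟨⟨t, by simpa using ht⟩, by simpa using h⟩

/-- The label of the key `x` with respect to the lists `A` and `B` of keys. -/
def label (A B : List ℕ) (x : ℕ) : Option Side :=
  if x ∈ A then some Side.L else if x ∈ B then some Side.R else none

theorem mem_ys_filter_graphPts {m : ℕ} {f : ℕ → ℕ} {A : List ℕ} {y : ℕ} :
    y ∈ ys ((graphPts m f).filter (fun p => p.1 ∈ A)) ↔ ∃ t < m, f t ∈ A ∧ t + 1 = y := by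
  simp only [ys, graphPts, Finset.mem_image, Finset.mem_filter, Finset.mem_range, Prod.exists,
    Prod.mk.injEq]
  constructor
  · rintro ⟨a, b, ⟨⟨t, ht, rfl, rfl⟩, h⟩, rfl⟩
    exact ⟨t, ht, h, rfl⟩
  · rintro ⟨t, ht, h, rfl⟩
    exact ⟨f t, t + 1, ⟨⟨t, ht, rfl, rfl⟩, h⟩, rfl⟩

/-- Sorting by time is reading the sequence in order, so the mixing string is the sequence itself
with irrelevant keys deleted. -/
theorem mixValue_graphPts (m : ℕ) (f : ℕ → ℕ) (A B : List ℕ) :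
    mixValue (ys ((graphPts m f).filter (fun p => p.1 ∈ A)))
      (ys ((graphPts m f).filter (fun p => p.1 ∈ B))) =
        blocks (((List.range m).map f).filterMap (label A B)) := by
  set U := ys ((graphPts m f).filter (fun p => p.1 ∈ A)) with hU
  set V := ys ((graphPts m f).filter (fun p => p.1 ∈ B)) with hV
  set l := ((List.range m).filter (fun t => f t ∈ A ∨ f t ∈ B)).map (· + 1) with hl
  have hlp : l.Pairwise (· < ·) := by
    refine List.Pairwise.map _ (fun a b (h : a < b) => by omega) ?_
    exact List.Pairwise.filter _ List.pairwise_lt_range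
  have hlU : l.toFinset = U ∪ V := by
    ext y
    simp only [hl, hU, hV, Finset.mem_union, mem_ys_filter_graphPts, List.mem_toFinset,
      List.mem_map, List.mem_filter, List.mem_range, decide_eq_true_eq]
    constructor
    · rintro ⟨t, ⟨ht, h | h⟩, rfl⟩
      exacts [Or.inl ⟨t, ht, h, rfl⟩, Or.inr ⟨t, ht, h, rfl⟩]
    · rintro (⟨t, ht, h, rfl⟩ | ⟨t, ht, h, rfl⟩)
      exacts [⟨t, ⟨ht, Or.inl h⟩, rfl⟩, ⟨t, ⟨ht, Or.inr h⟩, rfl⟩]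
  have hsort : (U ∪ V).sort (· ≤ ·) = l := by
    rw [← hlU]
    exact (List.toFinset_sort (r := (· ≤ ·)) (hlp.imp ne_of_lt)).2 (hlp.imp le_of_lt)
  unfold mixValue mix
  rw [hsort, hl, List.map_map, List.filterMap_map]
  congr 1
  have hUt : ∀ t < m, (t + 1 ∈ U ↔ f t ∈ A) := by
    intro t ht
    rw [hU, mem_ys_filter_graphPts]
    constructor
    · rintro ⟨u, _, h, e⟩
      obtain rfl : u = t := by omega
      exact h
    · exact fun h => ⟨t, ht, h, rfl⟩
  have key : ∀ L : List ℕ, (∀ t ∈ L, t < m) →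
      (L.filter (fun t => f t ∈ A ∨ f t ∈ B)).map
        ((fun x => if x ∈ U then Side.L else Side.R) ∘ (· + 1)) =
        L.filterMap (label A B ∘ f) := by
    intro L hL
    induction L with
    | nil => rfl
    | cons t L ih =>
      have ht := hUt t (hL t (by simp))
      have ih := ih fun u hu => hL u (by simp [hu])
      by_cases hA : f t ∈ A
      · simp [label, hA, ht, ← ih]
      · by_cases hB : f t ∈ B
        · simp [label, hA, hB, ht, ← ih]
        · simp [label, hA, hB, ← ih]
  exact key _ (by simp)

/-! ### Bit reversal -/

theorem bitRev_succ (k i : ℕ) : bitRev (k + 1) i = 2 ^ k * (i % 2) + bitRev k (i / 2) := by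
  unfold bitRev
  rw [Finset.sum_range_succ', add_comm]
  congr 1
  · rw [Nat.testBit_zero]
    rcases Nat.mod_two_eq_zero_or_one i with h | h <;> simp [h]
  · refine Finset.sum_congr rfl fun j _ => ?_
    rw [Nat.testBit_succ, show k + 1 - 1 - (j + 1) = k - 1 - j by omega]

theorem bitRev_lt (k i : ℕ) : bitRev k i < 2 ^ k := by
  induction k generalizing i with
  | zero => simp [bitRev]
  | succ k ih =>
    rw [bitRev_succ]
    have h1 := ih (i / 2)
    have h2 : i % 2 < 2 := Nat.mod_lt _ (by norm_num)
    have h3 : 2 ^ k * (i % 2) ≤ 2 ^ k * 1 := Nat.mul_le_mul_left _ (by omega)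
    rw [pow_succ]; omega

theorem bitRev_eq_iff (k i j : ℕ) : bitRev k i = bitRev k j ↔ i % 2 ^ k = j % 2 ^ k := by
  induction k generalizing i j with
  | zero => simp [bitRev, Nat.mod_one]
  | succ k ih =>
    rw [bitRev_succ, bitRev_succ, pow_succ', Nat.mod_mul, Nat.mod_mul]
    have h1 := bitRev_lt k (i / 2)
    have h2 := bitRev_lt k (j / 2)
    have := ih (i / 2) (j / 2)
    rcases Nat.mod_two_eq_zero_or_one i with hi | hi <;>
      rcases Nat.mod_two_eq_zero_or_one j with hj | hj <;> rw [hi, hj] <;> simp <;> omega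

theorem bitRev_mod (k i : ℕ) : bitRev k (i % 2 ^ k) = bitRev k i := by
  rw [bitRev_eq_iff, Nat.mod_mod]

theorem bitRev_add (s r i : ℕ) :
    bitRev (s + r) i = 2 ^ r * bitRev s i + bitRev r (i / 2 ^ s) := by
  induction s generalizing i with
  | zero => simp [bitRev]
  | succ s ih =>
    rw [show s + 1 + r = s + r + 1 by ring, bitRev_succ, bitRev_succ, ih, Nat.div_div_eq_div_mul,
      ← pow_succ', pow_add]
    ring

theorem bitRev_div {s k : ℕ} (h : s ≤ k) (i : ℕ) : bitRev k i / 2 ^ (k - s) = bitRev s i := by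
  obtain ⟨r, rfl⟩ := Nat.exists_eq_add_of_le h
  rw [Nat.add_sub_cancel_left, bitRev_add, Nat.mul_add_div (by positivity),
    Nat.div_eq_of_lt (bitRev_lt _ _), add_zero]

theorem bitReversal_perm (k : ℕ) : (bitReversal k).Perm (List.range (2 ^ k)) := by
  have hnd : (bitReversal k).Nodup := by
    refine List.Nodup.map_on (fun x hx y hy h => ?_) List.nodup_range
    rw [bitRev_eq_iff, Nat.mod_eq_of_lt (by simpa using hx), Nat.mod_eq_of_lt (by simpa using hy)]
      at h
    exact h
  refine (List.subperm_of_subset hnd ?_).perm_of_length_le (by simp [bitReversal])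
  intro x hx
  simp only [bitReversal, List.mem_map] at hx
  obtain ⟨i, _, rfl⟩ := hx
  simpa using bitRev_lt k i

/-! ### The access sequence as a function of time -/

theorem flatMap_range_map_range {β : Type*} (a : ℕ) {b : ℕ} (hb : 0 < b) (g : ℕ → ℕ → β) :
    (List.range a).flatMap (fun i => (List.range b).map (g i)) =
      (List.range (a * b)).map (fun t => g (t / b) (t % b)) := by
  induction a with
  | zero => simp
  | succ a ih =>
    rw [List.range_succ, List.flatMap_append, ih, Nat.succ_mul, List.range_add, List.map_append]
    congr 1
    simp only [List.flatMap_cons, List.flatMap_nil, List.append_nil, List.map_map]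
    refine List.map_congr_left fun j hj => ?_
    have hj : j < b := by simpa using hj
    have h : (a * b + j) / b = a := by
      rw [mul_comm, Nat.mul_add_div hb, Nat.div_eq_of_lt hj, add_zero]
    simp [h, Nat.mod_eq_of_lt hj]

/-- The key accessed by the sequence at time `t + 1`. -/
def keyAt (k t : ℕ) : ℕ := t / (numKeys k * 2 ^ k) + 2 ^ bitRev k t

theorem numKeys_pos (k : ℕ) : 0 < numKeys k := by unfold numKeys; positivity

theorem xTilde_eq (k : ℕ) :
    xTilde k = (List.range ((numKeys k / 2 + 1) * (numKeys k * 2 ^ k))).map (keyAt k) := by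
  have h1 : ∀ i, (List.replicate (numKeys k) (blockS k i)).flatten =
      (List.range (numKeys k * 2 ^ k)).map (fun t => i + 2 ^ bitRev k t) := by
    intro i
    have h2 : (List.replicate (numKeys k) (blockS k i)).flatten = (List.range (numKeys k)).flatMap
        (fun _ => (List.range (2 ^ k)).map (fun j => i + 2 ^ bitRev k j)) := by
      rw [List.flatMap, List.map_const', List.length_range, blockS, bitReversal, List.map_map]
      rfl
    rw [h2, flatMap_range_map_range _ (by positivity)]
    simp only [bitRev_mod]
  unfold xTilde
  simp only [h1]
  rw [flatMap_range_map_range _ (Nat.mul_pos (numKeys_pos k) (by positivity))]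
  refine List.map_congr_left fun t _ => ?_
  rw [keyAt, ← bitRev_mod k (t % _), Nat.mod_mod_of_dvd _ (Dvd.intro_left _ rfl), bitRev_mod]

theorem mem_blockS {k i x : ℕ} : x ∈ blockS k i ↔ ∃ b < 2 ^ k, i + 2 ^ b = x := by
  simp [blockS, (bitReversal_perm k).mem_iff]

theorem toFinset_xTilde (k : ℕ) : (xTilde k).toFinset = Finset.Icc 1 (numKeys k) := by
  have hn : numKeys k = 2 * 2 ^ (2 ^ k - 1) := by
    rw [numKeys, ← pow_succ', Nat.sub_add_cancel Nat.one_le_two_pow]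
  have h0 := numKeys_pos k
  ext x
  simp only [xTilde, List.mem_toFinset, List.mem_flatMap, List.mem_range, List.mem_flatten,
    List.mem_replicate, Finset.mem_Icc]
  constructor
  · rintro ⟨i, hi, l, ⟨_, rfl⟩, hx⟩
    obtain ⟨b, hb, rfl⟩ := mem_blockS.1 hx
    have : 2 ^ b ≤ 2 ^ (2 ^ k - 1) := Nat.pow_le_pow_right (by norm_num) (by omega)
    have : 0 < 2 ^ b := by positivity
    omega
  · rintro ⟨h1, h2⟩
    rcases le_total x (2 ^ (2 ^ k - 1)) with h | h
    · exact ⟨x - 1, by omega, _, ⟨h0.ne', rfl⟩, mem_blockS.2 ⟨0, by positivity, by simp; omega⟩⟩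
    · refine ⟨x - 2 ^ (2 ^ k - 1), by omega, _, ⟨h0.ne', rfl⟩, mem_blockS.2
        ⟨2 ^ k - 1, ?_, by omega⟩⟩
      have : 0 < 2 ^ k := by positivity
      omega

/-! ### The Funnel bound -/

theorem bitRev_sub_two_pow {s t : ℕ} (ht : 2 ^ s ≤ t) : bitRev s (t - 2 ^ s) = bitRev s t := by
  rw [bitRev_eq_iff]
  exact (Nat.mod_eq_sub_mod ht).symm

theorem bitRev_succ_eq (s t : ℕ) : bitRev (s + 1) t = 2 * bitRev s t + t / 2 ^ s % 2 := by
  rw [bitRev_add, bitRev_succ 0]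
  simp [bitRev]

/-- Subtracting `2 ^ s` keeps the bits below `s` and flips bit `s`. After reversal bit `s` is the
most significant one that changes, so comparing the top `s + 1` bits suffices. -/
theorem bitRev_sub_two_pow_lt {k s t : ℕ} (hs : s < k) (ht : 2 ^ s ≤ t) :
    (t.testBit s = true → bitRev k (t - 2 ^ s) < bitRev k t) ∧
      (t.testBit s = false → bitRev k t < bitRev k (t - 2 ^ s)) := by
  have h1 : (t - 2 ^ s) / 2 ^ s = t / 2 ^ s - 1 := by
    simpa using Nat.sub_mul_div t (2 ^ s) 1
  have h2 : 1 ≤ t / 2 ^ s := (Nat.one_le_div_iff (by positivity)).2 ht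
  have e1 := bitRev_succ_eq s t
  have e2 := bitRev_succ_eq s (t - 2 ^ s)
  rw [bitRev_sub_two_pow ht, h1] at e2
  rw [Nat.testBit_eq_decide_div_mod_eq, decide_eq_true_eq, decide_eq_false_iff_not]
  rw [← bitRev_div (show s + 1 ≤ k from hs)] at e1 e2
  exact ⟨fun h => Nat.lt_of_div_lt_div (c := 2 ^ (k - (s + 1))) (by omega),
    fun h => Nat.lt_of_div_lt_div (c := 2 ^ (k - (s + 1))) (by omega)⟩

/-- Between the times `t - 2 ^ s` and `t`, bit reversal takes no value between its values at these
two times. -/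
theorem eq_or_eq_of_bitRev_between {k s t u : ℕ} (hs : s ≤ k) (ht : 2 ^ s ≤ t)
    (h1 : t - 2 ^ s ≤ u) (h2 : u ≤ t)
    (h3 : min (bitRev k t) (bitRev k (t - 2 ^ s)) ≤ bitRev k u)
    (h4 : bitRev k u ≤ max (bitRev k t) (bitRev k (t - 2 ^ s))) : u = t ∨ u = t - 2 ^ s := by
  -- The top `s` bits of the reversal depend only on the residue mod `2 ^ s`; they agree at both
  -- ends, hence also at any value in between.
  have e : bitRev s u = bitRev s t := by
    have d1 := bitRev_div hs t
    have d2 := bitRev_div hs (t - 2 ^ s)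
    rw [bitRev_sub_two_pow ht] at d2
    have d3 := bitRev_div hs u
    rcases le_total (bitRev k t) (bitRev k (t - 2 ^ s)) with h | h
    · rw [min_eq_left h] at h3
      rw [max_eq_right h] at h4
      have := Nat.div_le_div_right (c := 2 ^ (k - s)) h3
      have := Nat.div_le_div_right (c := 2 ^ (k - s)) h4
      omega
    · rw [min_eq_right h] at h3
      rw [max_eq_left h] at h4
      have := Nat.div_le_div_right (c := 2 ^ (k - s)) h3
      have := Nat.div_le_div_right (c := 2 ^ (k - s)) h4
      omega
  rw [bitRev_eq_iff] at e
  obtain ⟨c, hc⟩ := (Nat.modEq_iff_dvd' h2).1 e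
  rcases c with _ | _ | c
  · left; simp at hc; omega
  · right; simp at hc; omega
  · have : 2 ^ s * (c + 1 + 1) = 2 ^ s * c + 2 ^ s + 2 ^ s := by ring
    have : 0 < 2 ^ s := by positivity
    have : 0 ≤ 2 ^ s * c := Nat.zero_le _
    omega

theorem mk_mem_graphPts {m t : ℕ} (f : ℕ → ℕ) (ht : t < m) : (f t, t + 1) ∈ graphPts m f :=
  Finset.mem_image.2 ⟨t, by simpa using ht, rfl⟩

theorem inRect_graphPts {f : ℕ → ℕ} {m k i s t : ℕ} (htm : t < m) (hs : s < k) (hkt : 2 ^ k ≤ t)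
    (hf : ∀ u ≤ t, t < u + 2 ^ k → f u = i + 2 ^ bitRev k u) :
    inRect (graphPts m f) (f t, t + 1) (f (t - 2 ^ s), t - 2 ^ s + 1) =
      {(f t, t + 1), (f (t - 2 ^ s), t - 2 ^ s + 1)} := by
  have hsk : 2 ^ s < 2 ^ k := Nat.pow_lt_pow_right (by norm_num) hs
  have hpos : 0 < 2 ^ s := by positivity
  have ft := hf t le_rfl (by omega)
  have fs := hf (t - 2 ^ s) (by omega) (by omega)
  ext ⟨x, y⟩
  simp only [inRect, Finset.mem_filter, Finset.mem_insert, Finset.mem_singleton]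
  constructor
  · rintro ⟨hmem, ⟨hx1, hx2⟩, hy1, hy2⟩
    simp only [graphPts, Finset.mem_image, Finset.mem_range, Prod.mk.injEq] at hmem
    obtain ⟨u, hu, rfl, rfl⟩ := hmem
    rw [min_eq_right (by omega)] at hy1
    rw [max_eq_left (by omega)] at hy2
    have fu := hf u (by omega) (by omega)
    rw [ft, fs, fu] at hx1 hx2
    have mono : ∀ {a b : ℕ}, i + 2 ^ a ≤ i + 2 ^ b → a ≤ b := fun {a b} h =>
      (Nat.pow_le_pow_iff_right (by norm_num : 1 < 2)).1 (by omega : 2 ^ a ≤ 2 ^ b)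
    have key := eq_or_eq_of_bitRev_between (u := u) hs.le (by omega : 2 ^ s ≤ t) (by omega)
      (by omega)
      (min_le_iff.2 ((min_le_iff.1 hx1).imp mono mono))
      (le_max_iff.2 ((le_max_iff.1 hx2).imp mono mono))
    rcases key with rfl | rfl <;> simp
  · rintro (h | h) <;> rw [Prod.mk.injEq] at h <;> obtain ⟨rfl, rfl⟩ := h
    · exact ⟨mk_mem_graphPts f htm, by simp⟩
    · exact ⟨mk_mem_graphPts f (by omega), by simp⟩

theorem blocks_bitString_le_mixValue_funnel {f : ℕ → ℕ} {m k i t : ℕ} (htm : t < m)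
    (hkt : 2 ^ k ≤ t) (hf : ∀ u ≤ t, t < u + 2 ^ k → f u = i + 2 ^ bitRev k u) :
    blocks (bitString k t) ≤ mixValue (ys (funnelL (graphPts m f) (f t, t + 1)))
      (ys (funnelR (graphPts m f) (f t, t + 1))) := by
  set A := ys (funnelL (graphPts m f) (f t, t + 1)) with hA
  set B := ys (funnelR (graphPts m f) (f t, t + 1)) with hB
  have hpow : ∀ s < k, 0 < 2 ^ s ∧ 2 ^ s < 2 ^ k := fun s hs =>
    ⟨by positivity, Nat.pow_lt_pow_right (by norm_num) hs⟩
  have hlt : ∀ s < k, (t.testBit s = true → f (t - 2 ^ s) < f t) ∧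
      (t.testBit s = false → f t < f (t - 2 ^ s)) := by
    intro s hs
    have := hpow s hs
    rw [hf t le_rfl (by omega), hf (t - 2 ^ s) (by omega) (by omega)]
    have h := bitRev_sub_two_pow_lt hs (by omega : 2 ^ s ≤ t)
    exact ⟨fun hb => Nat.add_lt_add_left (Nat.pow_lt_pow_right (by norm_num) (h.1 hb)) _,
      fun hb => Nat.add_lt_add_left (Nat.pow_lt_pow_right (by norm_num) (h.2 hb)) _⟩
  have memA : ∀ s < k, t.testBit s = true → t - 2 ^ s + 1 ∈ A := by
    intro s hs hb
    have := hpow s hs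
    refine Finset.mem_image.2 ⟨(f (t - 2 ^ s), t - 2 ^ s + 1), Finset.mem_filter.2
      ⟨mk_mem_graphPts f (by omega), ?_, (hlt s hs).1 hb, inRect_graphPts htm hs hkt hf⟩, rfl⟩
    show t - 2 ^ s + 1 < t + 1
    omega
  have memB : ∀ s < k, t.testBit s = false → t - 2 ^ s + 1 ∈ B := by
    intro s hs hb
    have := hpow s hs
    refine Finset.mem_image.2 ⟨(f (t - 2 ^ s), t - 2 ^ s + 1), Finset.mem_filter.2
      ⟨mk_mem_graphPts f (by omega), ?_, (hlt s hs).2 hb, inRect_graphPts htm hs hkt hf⟩, rfl⟩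
    show t - 2 ^ s + 1 < t + 1
    omega
  have notMemA : ∀ s < k, t.testBit s = false → t - 2 ^ s + 1 ∉ A := by
    intro s hs hb hmem
    have h := (hlt s hs).2 hb
    obtain ⟨q, hq, h2⟩ := Finset.mem_image.1 hmem
    obtain ⟨hq, _, h1, _⟩ := Finset.mem_filter.1 hq
    obtain ⟨u, _, rfl⟩ := Finset.mem_image.1 hq
    obtain rfl : u = t - 2 ^ s := by simpa using h2
    exact absurd h1 (by simpa using h.le)
  have hmap : bitString k t = ((List.range k).reverse.map (fun s => t - 2 ^ s + 1)).map
      (fun x => if x ∈ A then Side.L else Side.R) := by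
    rw [List.map_map, bitString]
    refine List.map_congr_left fun s hs => ?_
    have hs : s < k := by simpa using hs
    cases hb : t.testBit s
    · simp [notMemA s hs hb]
    · simp [memA s hs hb]
  rw [hmap]
  refine blocks_map_le_mixValue ?_ ?_
  · rw [List.pairwise_map, List.pairwise_reverse]
    refine List.Pairwise.imp_of_mem (R := (· < ·)) (fun {a b} ha hb hab => ?_)
      List.pairwise_lt_range
    have hb : b < k := by simpa using hb
    have := hpow b hb
    have : 2 ^ a < 2 ^ b := Nat.pow_lt_pow_right (by norm_num) hab
    omega
  · intro x hx
    simp only [List.mem_map, List.mem_reverse, List.mem_range] at hx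
    obtain ⟨s, hs, rfl⟩ := hx
    rw [Finset.mem_union]
    cases hb : t.testBit s
    exacts [Or.inr (memB s hs hb), Or.inl (memA s hs hb)]

theorem sum_range_mul {M : Type*} [AddCommMonoid M] (a b : ℕ) (g : ℕ → M) :
    ∑ t ∈ Finset.range (a * b), g t =
      ∑ i ∈ Finset.range a, ∑ j ∈ Finset.range b, g (i * b + j) := by
  induction a with
  | zero => simp
  | succ a ih => rw [Nat.succ_mul, Finset.sum_range_add, Finset.sum_range_succ, ih]

theorem le_funnel_xTilde (k : ℕ) :
    (numKeys k / 2 + 1) * ((numKeys k - 1) * (k * 2 ^ k)) ≤ 2 * Funnel (xTilde k) := by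
  set n := numKeys k with hn
  have hn0 : 0 < n := numKeys_pos k
  set D := ∑ t ∈ Finset.range (2 ^ k), blocks (bitString k t) with hD
  set m := (n / 2 + 1) * (n * 2 ^ k) with hm
  set g : ℕ → ℕ := fun t => mixValue (ys (funnelL (graphPts m (keyAt k)) (keyAt k t, t + 1)))
      (ys (funnelR (graphPts m (keyAt k)) (keyAt k t, t + 1))) with hg
  have hF : Funnel (xTilde k) = ∑ t ∈ Finset.range m, g t := by
    rw [Funnel, xTilde_eq, geom_map_range, funnelPts]
    refine Finset.sum_image fun a _ b _ h => ?_
    simpa using (Prod.mk.inj h).2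
  have hblock : ∀ i ∈ Finset.range (n / 2 + 1), (n - 1) * D ≤
      ∑ u ∈ Finset.range (n * 2 ^ k), g (i * (n * 2 ^ k) + u) := by
    intro i hi
    have hi : i < n / 2 + 1 := by simpa using hi
    -- The first copy of each block is dropped: the window of length `2 ^ k` before its accesses may
    -- reach into the previous shift.
    rw [sum_range_mul, show n = n - 1 + 1 by omega, Finset.sum_range_succ', show n - 1 + 1 = n by omega]
    refine le_trans ?_ (Nat.le_add_right _ _)
    have hconst : (n - 1) * D = ∑ _r ∈ Finset.range (n - 1), D := by simp
    rw [hconst]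
    refine Finset.sum_le_sum fun r hr => Finset.sum_le_sum fun j hj => ?_
    have hr : r < n - 1 := by simpa using hr
    have hj : j < 2 ^ k := by simpa using hj
    have hrj : (r + 1) * 2 ^ k + j < n * 2 ^ k := by
      have : (r + 1 + 1) * 2 ^ k ≤ n * 2 ^ k := Nat.mul_le_mul_right _ (by omega)
      rw [Nat.succ_mul] at this
      omega
    have hi' : (i + 1) * (n * 2 ^ k) ≤ m := Nat.mul_le_mul_right _ hi
    rw [Nat.succ_mul] at hi'
    have hr1 : (r + 1) * 2 ^ k = r * 2 ^ k + 2 ^ k := Nat.succ_mul _ _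
    have e : bitString k j = bitString k (i * (n * 2 ^ k) + ((r + 1) * 2 ^ k + j)) := by
      rw [← bitString_add_two_pow_mul k j (i * n + (r + 1))]
      congr 1
      ring
    rw [e]
    refine blocks_bitString_le_mixValue_funnel (i := i) (by omega) (by omega) fun u hu1 hu2 => ?_
    rw [keyAt, ← hn]
    congr 1
    refine Nat.div_eq_of_lt_le (by omega) ?_
    rw [Nat.succ_mul]
    omega
  have h1 := Finset.sum_le_sum hblock
  rw [Finset.sum_const, Finset.card_range, smul_eq_mul, ← sum_range_mul, ← hF] at h1
  have h2 : k * 2 ^ k ≤ 2 * D := mul_two_pow_le_two_mul_sum_blocks k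
  calc (n / 2 + 1) * ((n - 1) * (k * 2 ^ k))
      ≤ (n / 2 + 1) * ((n - 1) * (2 * D)) := by gcongr
    _ = 2 * ((n / 2 + 1) * ((n - 1) * D)) := by ring
    _ ≤ _ := by omega

/-! ### The Alternation bound -/

theorem blocks_flatMap_range_le (a : ℕ) (g : ℕ → List Side) :
    blocks ((List.range a).flatMap g) ≤ ∑ i ∈ Finset.range a, blocks (g i) := by
  induction a with
  | zero => simp [blocks]
  | succ a ih =>
    rw [List.range_succ, List.flatMap_append, Finset.sum_range_succ]
    refine (blocks_append_le _ _).trans ?_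
    simpa using ih

theorem count_label_L (A B X : List ℕ) :
    (X.filterMap (label A B)).count Side.L = X.countP (· ∈ A) := by
  induction X with
  | nil => rfl
  | cons x X ih =>
    by_cases hA : x ∈ A
    · simp [label, hA, ← ih]
    · by_cases hB : x ∈ B <;> simp [label, hA, hB, ← ih]

theorem count_label_R_le (A B X : List ℕ) :
    (X.filterMap (label A B)).count Side.R ≤ X.countP (· ∈ B) := by
  induction X with
  | nil => simp
  | cons x X ih =>
    by_cases hA : x ∈ A
    · by_cases hB : x ∈ B <;> simp [label, hA, hB] <;> omega
    · by_cases hB : x ∈ B <;> simp [label, hA, hB] <;> omega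

theorem countP_flatten_replicate {β : Type*} (p : β → Bool) (n : ℕ) (l : List β) :
    (List.replicate n l).flatten.countP p = n * l.countP p := by
  induction n with
  | zero => simp
  | succ n ih => rw [List.replicate_succ, List.flatten_cons, List.countP_append, ih]; ring

/-- The exponents `b < 2 ^ k` for which the key `i + 2 ^ b` lies in `[a, a + l)`. -/
def hits (k a l i : ℕ) : Finset ℕ :=
  (Finset.range (2 ^ k)).filter (fun b => a ≤ i + 2 ^ b ∧ i + 2 ^ b < a + l)

theorem mem_hits {k a l i b : ℕ} :
    b ∈ hits k a l i ↔ b < 2 ^ k ∧ a ≤ i + 2 ^ b ∧ i + 2 ^ b < a + l := by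
  simp [hits]

theorem countP_blockS (k a l i : ℕ) :
    (blockS k i).countP (· ∈ List.range' a l) = (hits k a l i).card := by
  rw [blockS, List.countP_map, (bitReversal_perm k).countP_eq, List.countP_eq_length_filter]
  have h : (hits k a l i).card = ((List.range (2 ^ k)).filter
      (fun b => a ≤ i + 2 ^ b ∧ i + 2 ^ b < a + l)).length := rfl
  rw [h]
  congr 2
  ext b
  simp [List.mem_range'_1]

/-- The less frequent letter limits the number of runs; either letter may play that role. -/
theorem blocks_label_le (k a l r i n : ℕ) :
    blocks ((List.replicate n (blockS k i)).flatten.filterMap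
      (label (List.range' a l) (List.range' (a + l) r))) ≤
        2 * n * min (hits k a l i).card (hits k (a + l) r i).card + 1 := by
  set s := (List.replicate n (blockS k i)).flatten.filterMap
      (label (List.range' a l) (List.range' (a + l) r)) with hs
  have hL := (blocks_le_two_mul_count s Side.L).1
  have hR := (blocks_le_two_mul_count s Side.R).1
  have h1 : s.count Side.L = n * (hits k a l i).card := by
    rw [hs, count_label_L, countP_flatten_replicate, countP_blockS]
  have h2 : s.count Side.R ≤ n * (hits k (a + l) r i).card := by
    refine (count_label_R_le _ _ _).trans_eq ?_
    rw [countP_flatten_replicate, countP_blockS]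
  rw [mul_assoc]
  rcases le_total (hits k a l i).card (hits k (a + l) r i).card with h | h
  · rw [min_eq_left h]; omega
  · rw [min_eq_right h]; omega

theorem sum_card_filter_le_sum (M K : ℕ) (R : ℕ → ℕ → Prop) [∀ i b, Decidable (R i b)]
    (w : ℕ → ℕ) (h : ∀ b < K, ((Finset.range M).filter (fun i => R i b)).card ≤ w b) :
    ∑ i ∈ Finset.range M, ((Finset.range K).filter (fun b => R i b)).card ≤
      ∑ b ∈ Finset.range K, w b := by
  simp only [Finset.card_filter] at h ⊢
  rw [Finset.sum_comm]
  exact Finset.sum_le_sum fun b hb => h b (by simpa using hb)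

theorem card_filter_range_le {M c d w : ℕ} (p : ℕ → Prop) [DecidablePred p]
    (h : ∀ i, p i → c ≤ i ∧ i < d) (hw : d - c ≤ w) :
    ((Finset.range M).filter p).card ≤ w := by
  refine le_trans (Finset.card_le_card (t := Finset.Ico c d) fun i hi => ?_) (by simpa using hw)
  rw [Finset.mem_Ico]
  exact h i (Finset.mem_filter.1 hi).2

/-- The larger power is at least twice the smaller, so it is at most twice their difference, and
that difference is less than `l + r`. -/
theorem two_pow_lt_of_mem_hits {k a l r i b b' : ℕ} (hb : b ∈ hits k a l i)
    (hb' : b' ∈ hits k (a + l) r i) :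
    2 ^ b < 2 * (l + r) ∧ 2 ^ b' < 2 * (l + r) ∧ i < a + l := by
  rw [mem_hits] at hb hb'
  have hlt : b < b' := (Nat.pow_lt_pow_iff_right (by norm_num : 1 < 2)).1
    (by omega : 2 ^ b < 2 ^ b')
  have : 2 ^ (b + 1) ≤ 2 ^ b' := Nat.pow_le_pow_right (by norm_num) hlt
  rw [pow_succ] at this
  have : 0 < 2 ^ b := by positivity
  omega

/-- Double counting: the minimum is bounded by the hits on one side, and for each `b` the admissible
shifts `i` lie in an interval of length at most `min (2 ^ b) (min l r)`. -/
theorem sum_min_card_hits_le (M k a l r : ℕ) :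
    ∑ i ∈ Finset.range M, min (hits k a l i).card (hits k (a + l) r i).card ≤
      2 * ∑ b ∈ Finset.range (2 ^ k), if 2 ^ b < 2 * (l + r) then min (2 ^ b) (min l r) else 0 := by
  set w : ℕ → ℕ := fun b => if 2 ^ b < 2 * (l + r) then min (2 ^ b) (min l r) else 0 with hw
  have hleft : ∀ i, min (hits k a l i).card (hits k (a + l) r i).card ≤
      ((Finset.range (2 ^ k)).filter (fun b => 2 ^ b < 2 * (l + r) ∧ i < a + l ∧
        a ≤ i + 2 ^ b ∧ i + 2 ^ b < a + l)).card := by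
    intro i
    rcases (hits k (a + l) r i).eq_empty_or_nonempty with h | ⟨b', hb'⟩
    · simp [h]
    · refine (min_le_left _ _).trans (Finset.card_le_card fun b hb => ?_)
      have := two_pow_lt_of_mem_hits hb hb'
      rw [mem_hits] at hb
      simp only [Finset.mem_filter, Finset.mem_range]
      tauto
  have hright : ∀ i, min (hits k a l i).card (hits k (a + l) r i).card ≤
      ((Finset.range (2 ^ k)).filter (fun b => 2 ^ b < 2 * (l + r) ∧ i < a + l ∧
        a + l ≤ i + 2 ^ b ∧ i + 2 ^ b < a + l + r)).card := by
    intro i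
    rcases (hits k a l i).eq_empty_or_nonempty with h | ⟨b', hb'⟩
    · simp [h]
    · refine (min_le_right _ _).trans (Finset.card_le_card fun b hb => ?_)
      have := two_pow_lt_of_mem_hits hb' hb
      rw [mem_hits] at hb
      simp only [Finset.mem_filter, Finset.mem_range]
      tauto
  rcases le_total r l with hrl | hlr
  · refine (Finset.sum_le_sum fun i _ => hright i).trans ?_
    refine (sum_card_filter_le_sum _ _ _ w fun b _ => ?_).trans
      (Nat.le_mul_of_pos_left _ (by norm_num))
    have hpos : 0 < 2 ^ b := by positivity
    simp only [hw, min_eq_right hrl]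
    split_ifs with hb
    · refine le_min (card_filter_range_le (c := a + l - 2 ^ b) (d := a + l) _ ?_ (by omega))
        (card_filter_range_le (c := a + l - 2 ^ b) (d := a + l + r - 2 ^ b) _ ?_ (by omega)) <;>
        intro i hi <;> omega
    · simp [hb]
  -- When `l` is the smaller side, right hits are counted only for the `l` shifts in `[a, a + l)`,
  -- and left hits for `i < a`. The two cases account for the factor 2.
  · have hsplit : ∀ i ∈ Finset.range M, min (hits k a l i).card (hits k (a + l) r i).card ≤
        ((Finset.range (2 ^ k)).filter (fun b => 2 ^ b < 2 * (l + r) ∧ a ≤ i ∧ i < a + l ∧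
          a + l ≤ i + 2 ^ b)).card +
        ((Finset.range (2 ^ k)).filter (fun b => 2 ^ b < 2 * (l + r) ∧ i < a ∧
          a ≤ i + 2 ^ b ∧ i + 2 ^ b < a + l)).card := by
      intro i _
      by_cases hi : a ≤ i
      · refine ((hright i).trans (Finset.card_le_card fun b hb => ?_)).trans (Nat.le_add_right _ _)
        simp only [Finset.mem_filter] at hb ⊢
        tauto
      · refine ((hleft i).trans (Finset.card_le_card fun b hb => ?_)).trans (Nat.le_add_left _ _)
        simp only [Finset.mem_filter] at hb ⊢
        have := not_le.1 hi
        tauto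
    refine (Finset.sum_le_sum hsplit).trans ?_
    rw [Finset.sum_add_distrib, two_mul (Finset.sum _ w)]
    refine Nat.add_le_add (sum_card_filter_le_sum _ _ _ w fun b _ => ?_)
      (sum_card_filter_le_sum _ _ _ w fun b _ => ?_)
    · have hpos : 0 < 2 ^ b := by positivity
      simp only [hw, min_eq_left hlr]
      split_ifs with hb
      · refine le_min (card_filter_range_le (c := a + l - 2 ^ b) (d := a + l) _ ?_ (by omega))
          (card_filter_range_le (c := a) (d := a + l) _ ?_ (by omega)) <;>
          intro i hi <;> omega
      · simp [hb]
    · have hpos : 0 < 2 ^ b := by positivity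
      simp only [hw, min_eq_left hlr]
      split_ifs with hb
      · refine le_min (card_filter_range_le (c := a - 2 ^ b) (d := a) _ ?_ (by omega))
          (card_filter_range_le (c := a - 2 ^ b) (d := a + l - 2 ^ b) _ ?_ (by omega)) <;>
          intro i hi <;> omega
      · simp [hb]

/-- The potential by which the contributions of the step `B` to the nodes of a reference tree with
`N` leaves are bounded. -/
def potential (B N : ℕ) : ℕ := if B < 2 * N then 3 * N - B else 0

/-- If both children have positive potential, merging them frees one `B`, which pays `B`. If exactly
one does, the other child's leaves pay. If neither does but the node does, `B < 2 * (l + r)` leaves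
more than `l + r`. -/
theorem potential_add_le (B l r : ℕ) :
    (if B < 2 * (l + r) then min B (min l r) else 0) + potential B l + potential B r ≤
      potential B (l + r) := by
  unfold potential
  split_ifs <;> omega

theorem mixValue_geom_xTilde_le (k a l r : ℕ) :
    mixValue (ys ((geom (xTilde k)).filter (fun p => p.1 ∈ List.range' a l)))
      (ys ((geom (xTilde k)).filter (fun p => p.1 ∈ List.range' (a + l) r))) ≤
        4 * numKeys k * (∑ b ∈ Finset.range (2 ^ k),
          if 2 ^ b < 2 * (l + r) then min (2 ^ b) (min l r) else 0) + (numKeys k / 2 + 1) := by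
  have h1 : mixValue (ys ((geom (xTilde k)).filter (fun p => p.1 ∈ List.range' a l)))
      (ys ((geom (xTilde k)).filter (fun p => p.1 ∈ List.range' (a + l) r))) =
        blocks ((xTilde k).filterMap (label (List.range' a l) (List.range' (a + l) r))) := by
    rw [xTilde_eq, geom_map_range, mixValue_graphPts]
  rw [h1, xTilde, List.filterMap_flatMap]
  refine (blocks_flatMap_range_le _ _).trans
    ((Finset.sum_le_sum fun i _ => blocks_label_le k a l r i (numKeys k)).trans ?_)
  rw [Finset.sum_add_distrib, ← Finset.mul_sum]
  have h2 := Nat.mul_le_mul_left (2 * numKeys k)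
    (sum_min_card_hits_le (numKeys k / 2 + 1) k a l r)
  simp only [Finset.sum_const, Finset.card_range, smul_eq_mul, mul_one]
  refine Nat.add_le_add_right (h2.trans_eq ?_) _
  ring

/-- Lets the recursion run with one fixed point set instead of restricted ones. -/
theorem altPts_filter {α : Type*} [LinearOrder α] (T : RefTree α) (P : Finset (α × α))
    (S : List α) (h : ∀ x ∈ T.leaves, x ∈ S) :
    altPts T (P.filter (fun p => p.1 ∈ S)) = altPts T P := by
  cases T with
  | leaf a => rfl
  | node l r =>
    have hf : ∀ t : List α, (∀ x ∈ t, x ∈ S) →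
        (P.filter (fun p => p.1 ∈ S)).filter (fun p => p.1 ∈ t) = P.filter (fun p => p.1 ∈ t) := by
      intro t ht
      rw [Finset.filter_filter]
      exact Finset.filter_congr fun p _ => ⟨fun h => h.2, fun h => ⟨ht _ h, h⟩⟩
    have hl := hf l.leaves fun x hx => h x (by simp [RefTree.leaves, hx])
    have hr := hf r.leaves fun x hx => h x (by simp [RefTree.leaves, hx])
    simp only [altPts, hl, hr]

theorem altPts_node {α : Type*} [LinearOrder α] (l r : RefTree α) (P : Finset (α × α)) :
    altPts (.node l r) P =
      mixValue (ys (P.filter (fun p => p.1 ∈ l.leaves))) (ys (P.filter (fun p => p.1 ∈ r.leaves)))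
        + altPts l P + altPts r P := by
  rw [altPts, altPts_filter l P _ fun _ h => h, altPts_filter r P _ fun _ h => h]

/-- A tree with `N` leaves has `N - 1` inner nodes, and each pays one extra run for every shift;
hence the subtracted term. -/
theorem altPts_xTilde_le (k : ℕ) (T : RefTree ℕ) (a N : ℕ) (hT : T.leaves = List.range' a N) :
    altPts T (geom (xTilde k)) ≤ 4 * numKeys k * ∑ b ∈ Finset.range (2 ^ k), potential (2 ^ b) N +
      (numKeys k / 2 + 1) * N - (numKeys k / 2 + 1) := by
  induction T generalizing a N with
  | leaf x => simp [altPts]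
  | node l r ihl ihr =>
    rw [RefTree.leaves] at hT
    obtain ⟨L, hLN, hl, hr⟩ := List.range'_eq_append_iff.1 hT.symm
    obtain ⟨R, rfl⟩ := Nat.exists_eq_add_of_le hLN
    rw [Nat.add_sub_cancel_left, mul_one] at hr
    have hpos : ∀ T : RefTree ℕ, 0 < T.leaves.length := by
      intro T
      induction T with
      | leaf => simp [RefTree.leaves]
      | node l r ih _ => simp only [RefTree.leaves, List.length_append]; omega
    have hL := hpos l
    have hR := hpos r
    rw [hl, List.length_range'] at hL
    rw [hr, List.length_range'] at hR
    have h1 := ihl _ _ hl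
    have h2 := ihr _ _ hr
    have h3 := mixValue_geom_xTilde_le k a L R
    rw [altPts_node, hl, hr]
    have h4 : (∑ b ∈ Finset.range (2 ^ k),
          if 2 ^ b < 2 * (L + R) then min (2 ^ b) (min L R) else 0) +
        ∑ b ∈ Finset.range (2 ^ k), potential (2 ^ b) L +
        ∑ b ∈ Finset.range (2 ^ k), potential (2 ^ b) R ≤
        ∑ b ∈ Finset.range (2 ^ k), potential (2 ^ b) (L + R) := by
      rw [← Finset.sum_add_distrib, ← Finset.sum_add_distrib]
      exact Finset.sum_le_sum fun b _ => potential_add_le _ _ _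
    have h5 := Nat.mul_le_mul_left (4 * numKeys k) h4
    have h6 : (numKeys k / 2 + 1) * 1 ≤ (numKeys k / 2 + 1) * L := Nat.mul_le_mul_left _ hL
    have h7 : (numKeys k / 2 + 1) * 1 ≤ (numKeys k / 2 + 1) * R := Nat.mul_le_mul_left _ hR
    rw [mul_add, mul_add] at h5
    rw [mul_add (numKeys k / 2 + 1) L R]
    omega

theorem Alt_xTilde_le (k : ℕ) (T : RefTree ℕ) (hT : T.IsRefTree (geom (xTilde k))) :
    Alt T (xTilde k) ≤ 25 * ((numKeys k / 2 + 1) * numKeys k * 2 ^ k) := by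
  set n := numKeys k with hn
  have hxs : xs (geom (xTilde k)) = (xTilde k).toFinset := by
    ext x
    simp [xs, geom, List.mem_iff_get]
  have hleaves : T.leaves = List.range' 1 n := by
    refine List.Perm.eq_of_pairwise (le := (· < ·)) (fun a b _ _ h h' => absurd h h'.asymm) hT.1
      List.pairwise_lt_range' ?_
    rw [List.perm_ext_iff_of_nodup (hT.1.imp ne_of_lt) List.nodup_range']
    intro x
    rw [← List.mem_toFinset, hT.2, hxs, toFinset_xTilde, Finset.mem_Icc, List.mem_range'_1]
    omega
  have h1 : ∑ b ∈ Finset.range (2 ^ k), potential (2 ^ b) n ≤ 2 ^ k * (3 * n) := by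
    refine (Finset.sum_le_sum (g := fun _ => 3 * n) fun b _ => ?_).trans (by simp)
    unfold potential
    split_ifs
    exacts [Nat.sub_le _ _, Nat.zero_le _]
  have h2 : n ≤ 2 * (n / 2 + 1) := by omega
  have h3 : 1 ≤ 2 ^ k := Nat.one_le_two_pow
  -- The constant is `25 = 4 * 3 * 2 + 1`: runs per hit, potential per leaf, `n ≤ 2 * (n / 2 + 1)`,
  -- and the extra runs.
  calc Alt T (xTilde k)
      ≤ 4 * n * ∑ b ∈ Finset.range (2 ^ k), potential (2 ^ b) n + (n / 2 + 1) * n :=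
        (altPts_xTilde_le k T 1 n hleaves).trans (Nat.sub_le _ _)
    _ ≤ 4 * n * (2 ^ k * (3 * (2 * (n / 2 + 1)))) + (n / 2 + 1) * n * 2 ^ k := by
        refine Nat.add_le_add (Nat.mul_le_mul_left _ (h1.trans (by gcongr))) ?_
        exact Nat.le_mul_of_pos_right _ h3
    _ = 25 * ((n / 2 + 1) * n * 2 ^ k) := by ring

end Wilber

theorem theorem2 :
    ∃ c C : ℝ, 0 < c ∧ 0 < C ∧ ∀ k : ℕ, 1 ≤ k → ∀ n m : ℕ, ∀ X : List ℕ,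
      n = 2 ^ (2 ^ k) → X = Wilber.xTilde k → m = X.length →
        X.toFinset = Finset.Icc 1 n ∧
        m = (n / 2 + 1) * n * 2 ^ k ∧
        (∀ T : Wilber.RefTree ℕ, T.IsRefTree (Wilber.geom X) →
          (Wilber.Alt T X : ℝ) ≤ C * (m : ℝ)) ∧
        c * ((m : ℝ) * Real.logb 2 (Real.logb 2 (n : ℝ))) ≤ (Wilber.Funnel X : ℝ) ∧
        (∀ T : Wilber.RefTree ℕ, T.IsRefTree (Wilber.geom X) →
          c * Real.logb 2 (Real.logb 2 (n : ℝ)) * ((Wilber.Alt T X : ℝ) + (m : ℝ))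
            ≤ (Wilber.Funnel X : ℝ)) := by
  -- `104 = 4 * 26`: the Funnel bound is at least `m * k / 4`, while the Alternation bound plus `m`
  -- is at most `26 * m`.
  refine ⟨1 / 104, 25, by norm_num, by norm_num, ?_⟩
  intro k _ n m X hn hX hm
  have hnk : n = Wilber.numKeys k := hn
  have hlog : Real.logb 2 (Real.logb 2 (n : ℝ)) = k := by
    have h2 : Real.logb 2 (2 : ℝ) = 1 := Real.logb_self_eq_one (by norm_num)
    rw [hn]
    push_cast
    rw [Real.logb_pow, h2, mul_one]
    push_cast
    rw [Real.logb_pow, h2, mul_one]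
  have hm' : m = (n / 2 + 1) * n * 2 ^ k := by
    rw [hm, hX, Wilber.xTilde_eq, List.length_map, List.length_range, hnk, mul_assoc]
  have hA : ∀ T : Wilber.RefTree ℕ, T.IsRefTree (Wilber.geom X) →
      (Wilber.Alt T X : ℝ) ≤ 25 * (m : ℝ) := by
    intro T hT
    rw [hX] at hT ⊢
    rw [hm', hnk]
    exact_mod_cast Wilber.Alt_xTilde_le k T hT
  have hF : (m : ℝ) * k ≤ 4 * (Wilber.Funnel X : ℝ) := by
    have h1 := Wilber.le_funnel_xTilde k
    rw [← hX, ← hnk] at h1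
    -- Losing one of the `n` copies costs at most a factor 2.
    have h2 : n ≤ 2 * (n - 1) := by
      have : 2 ^ 1 ≤ n := hn ▸ Nat.pow_le_pow_right (by norm_num) Nat.one_le_two_pow
      omega
    have h3 : m * k ≤ 4 * Wilber.Funnel X := by
      calc m * k = (n / 2 + 1) * (n * (k * 2 ^ k)) := by rw [hm']; ring
        _ ≤ (n / 2 + 1) * (2 * (n - 1) * (k * 2 ^ k)) := by gcongr
        _ = 2 * ((n / 2 + 1) * ((n - 1) * (k * 2 ^ k))) := by ring
        _ ≤ 4 * Wilber.Funnel X := by omega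
    exact_mod_cast h3
  have hmk : 0 ≤ (m : ℝ) * k := by positivity
  refine ⟨?_, hm', hA, ?_, ?_⟩
  · rw [hX, hnk, Wilber.toFinset_xTilde]
  · rw [hlog]
    linarith
  · intro T hT
    rw [hlog]
    have := mul_le_mul_of_nonneg_left (hA T hT) (Nat.cast_nonneg (α := ℝ) k)
    linarith
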